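/- Let $T_H=(V_H,E_H,F_H)$ be the infinite hexagonal triangulation of the plane, i.e. the tiling of the plane by equilateral triangles with vertex set $V_H=\{m+n\omega: m,n\in\mathbb Z\}$, $\omega=e^{\pi i/3}$, in which two vertices are joined by an edge when their distance is $1$, and every vertex has degree $6$. A PL metric on $T_H$ is a function $l:E_H\to(0,\infty)$ that satisfies the strict triangle inequalities in every face. For $u:V_H\to\mathbb R$ let $u*l$ be given by $(u*l)_{ij}=e^{\frac12(u_i+u_j)}\,l_{ij}$, and let $d_{reg}\equiv 1$ be the regular metric. The discrete Gaussian curvature of a PL metric at a vertex $i$ is $K_i=2\pi-\sum_{\Delta ijk\in F_H}\theta_i^{jk}$, where $\theta_i^{jk}$ is the inner angle at $i$ of the Euclidean triangle $\Delta ijk$ with the given edge lengths. For $\phi:V_H\to\mathbb R$, a global solution of the combinatorial Yamabe flow with initial metric $\phi*d_{reg}$ is a family $u(t):V_H\to\mathbb R$, $t\in[0,\infty)$, such that $u(0)=\phi$ and, for all $t\ge 0$, $u(t)*d_{reg}$ is a PL metric and $$\frac{\mathrm d u_i}{\mathrm d t}(t)=-K_i\big(u(t)*d_{reg}\big)\qquad\text{for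 all } i\in V_H .$$ There is a universal constant $\epsilon_0>0$ such that for every $\phi\in\ell^2(V_H)$ with $\|\phi\|_{\ell^2}\le\epsilon_0$ the flow with initial metric $\phi*d_{reg}$ has a unique global solution $u(t)$. Moreover, $u(t)*d_{reg}$ converges to the regular metric as $t\to\infty$: the Dirichlet energy $\mathcal E(u(t))=\sum_{ij\in E_H}|u_i(t)-u_j(t)|^2$ is finite for every $t\ge 0$ and tends to $0$, and the edge lengths $(u(t)*d_{reg})_{ij}$ tend to $1$ uniformly in $ij\in E_H$. -/

import Mathlib

/-- Vertices of the infinite hexagonal triangulation `T_H` of the plane. The pair `(m, n)` stands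
for the point `m + n ω` of the complex plane, `ω = exp (π i / 3)`. -/
abbrev HexVertex : Type := ℤ × ℤ

/-- The 1-skeleton of `T_H`: two lattice points are joined by an edge when they are at Euclidean
distance `1`, i.e. when they differ by one of `±1`, `±ω`, `±(1 - ω)`. Every vertex has degree 6. -/
def hexGraph : SimpleGraph HexVertex where
  Adj i j := j - i ∈ ({(1, 0), (0, 1), (-1, 1), (-1, 0), (0, -1), (1, -1)} : Set HexVertex)
  symm := ⟨by
    intro i j h
    have e : i - j = -(j - i) := (neg_sub j i).symm
    simp only [Set.mem_insert_iff, Set.mem_singleton_iff] at h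
    rw [e]
    rcases h with h | h | h | h | h | h <;> rw [h] <;> simp⟩
  loopless := ⟨by
    intro i h
    simp [Prod.ext_iff] at h⟩

/-- `{i, j, k}` is a face of `T_H`. In this triangulation the faces are exactly the triples of
pairwise adjacent vertices. -/
def IsHexFace (i j k : HexVertex) : Prop :=
  hexGraph.Adj i j ∧ hexGraph.Adj j k ∧ hexGraph.Adj k i

/-- A PL metric on `T_H`: `l i j` is the length of the edge `ij` (the values of `l` at pairs of
vertices that are not adjacent are irrelevant). Lengths are positive and satisfy the strict
triangle inequalities in each face. -/
structure IsPLMetric (l : HexVertex → HexVertex → ℝ) : Prop where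
  symm : ∀ i j, hexGraph.Adj i j → l i j = l j i
  pos : ∀ i j, hexGraph.Adj i j → 0 < l i j
  triangle : ∀ i j k, IsHexFace i j k → l i j < l i k + l k j

/-- The regular metric `d_reg ≡ 1`. -/
def regularMetric : HexVertex → HexVertex → ℝ := fun _ _ => 1

/-- The discrete conformal change `u ∗ l`. -/
noncomputable def conformalChange (u : HexVertex → ℝ) (l : HexVertex → HexVertex → ℝ) :
    HexVertex → HexVertex → ℝ :=
  fun i j => Real.exp ((u i + u j) / 2) * l i j

/-- The inner angle at the vertex `i` of the Euclidean triangle `ijk` with edge lengths given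
by `l` (law of cosines). -/
noncomputable def innerAngle (l : HexVertex → HexVertex → ℝ) (i j k : HexVertex) : ℝ :=
  Real.arccos ((l i j ^ 2 + l i k ^ 2 - l j k ^ 2) / (2 * l i j * l i k))

/-- The discrete Gaussian curvature `K_i = 2π - ∑ θ_i^{jk}`, the sum running over the faces that
contain `i`. The finite sum below runs over the ordered pairs `(j, k)` such that `ijk` is a face,
so it counts every face at `i` twice, whence the factor `1 / 2`. -/
noncomputable def discreteCurvature (l : HexVertex → HexVertex → ℝ) (i : HexVertex) : ℝ :=
  2 * Real.pi -
    (1 / 2) * ∑ᶠ p ∈ {p : HexVertex × HexVertex | IsHexFace i p.1 p.2}, innerAngle l i p.1 p.2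

/-- `u` is a global solution (for all times `t ≥ 0`) of the combinatorial Yamabe flow
`du_i/dt = -K_i(u ∗ d_reg)` with `u(0) = φ`. Only the values `u t` for `t ≥ 0` matter; the
derivative at `t = 0` is one-sided. -/
structure IsGlobalYamabeFlow (φ : HexVertex → ℝ) (u : ℝ → HexVertex → ℝ) : Prop where
  initial : u 0 = φ
  metric : ∀ t, 0 ≤ t → IsPLMetric (conformalChange (u t) regularMetric)
  flow : ∀ t, 0 ≤ t → ∀ i, HasDerivWithinAt (fun s => u s i)
    (-discreteCurvature (conformalChange (u t) regularMetric) i) (Set.Ici 0) t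

/-- `|u_i - u_j|²` as a function of the unordered pair `ij`. -/
def edgeDiffSq (u : HexVertex → ℝ) : Sym2 HexVertex → ℝ :=
  Sym2.lift ⟨fun i j => |u i - u j| ^ 2, fun i j => by simp only [abs_sub_comm]⟩

/-- The Dirichlet energy `∑_{ij ∈ E_H} |u_i - u_j|²`. -/
noncomputable def dirichletEnergy (u : HexVertex → ℝ) : ℝ :=
  ∑' e : hexGraph.edgeSet, edgeDiffSq u e

/-! In a triangle of `u * d_reg` the angle at `i` depends only on the two differences of `u` along
the sides at `i`. At the equilateral triangle its linear part is `(x + y) / (2√3)`, so the flow is a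
nonlinear perturbation of the heat equation on the triangular lattice.

Testing the equation against `u` and collecting the three corners of each face, the linear part
gives minus a multiple of the Dirichlet energy. The error is quadratic in the differences and
carries a factor `|u_i|`, so for small `u` it is absorbed. Hence `d/dt ‖u‖² ≤ -E/4`
(`CornerAngleBounds.inner_l2Field_le`). Small `ℓ²` balls are invariant, and a globally Lipschitz
modification of the field on `ℓ²` has a global solution that never sees the modification
(`CornerAngleBounds.exists_l2_flow`).

Since `‖u‖²` converges and the solution moves with bounded speed, the energy cannot stay away from
zero or return there in short bursts (`tendsto_l2Energy_of_dissipation`). An Agmon inequality along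
a lattice ray (`sq_le_l2Energy`) turns this into uniform decay of `u`, hence of the edge lengths to
`1`.

Uniqueness is among all solutions, not only those in `ℓ²`. Angles lie in `[0, π]`, so every solution
has speed at most `6π` and stays in the Lipschitz region for a time step of fixed length; iterating
a sup-norm contraction over such steps gives `CornerAngleBounds.flow_unique`. -/

/-! ### The corner angle near the equilateral triangle -/

/-- The angle at `i` of the triangle `ijk` in the metric `u ∗ d_reg`, as a function of
`x = u_j - u_i` and `y = u_k - u_i`. -/
noncomputable def cornerAngle (x y : ℝ) : ℝ :=
  Real.arccos (Real.cosh ((x - y) / 2) - Real.exp ((x + y) / 2) / 2)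

lemma cornerAngle_comm (x y : ℝ) : cornerAngle x y = cornerAngle y x := by
  unfold cornerAngle
  rw [← Real.cosh_neg, add_comm x y]
  congr 3
  ring

lemma cornerAngle_zero : cornerAngle 0 0 = Real.pi / 3 := by
  unfold cornerAngle
  rw [← Real.arccos_cos (by positivity : (0 : ℝ) ≤ Real.pi / 3) (by linarith [Real.pi_pos]),
    Real.cos_pi_div_three]
  norm_num

lemma cornerAngle_nonneg (x y : ℝ) : 0 ≤ cornerAngle x y := Real.arccos_nonneg _

lemma cornerAngle_le_pi (x y : ℝ) : cornerAngle x y ≤ Real.pi := Real.arccos_le_pi _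

/-- A `C²` function is approximated by its differential up to a quadratic error. -/
lemma ContDiffAt.exists_quadratic_remainder {E : Type*} [NormedAddCommGroup E] [NormedSpace ℝ E]
    {f : E → ℝ} {a : E} (hf : ContDiffAt ℝ 2 f a) :
    ∃ K : ℝ, ∃ r > 0, ∀ z, ‖z - a‖ < r →
      ‖f z - f a - fderiv ℝ f a (z - a)‖ ≤ K * ‖z - a‖ ^ 2 := by
  have h1 : ContDiffAt ℝ 1 (fderiv ℝ f) a := hf.fderiv_right (by norm_num)
  obtain ⟨K, t, ht, hK⟩ := h1.exists_lipschitzOnWith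
  have hd : ∀ᶠ z in nhds a, DifferentiableAt ℝ f z :=
    (hf.eventually (by simp)).mono fun z hz => hz.differentiableAt (by norm_num)
  obtain ⟨r, hr, hrt⟩ := Metric.mem_nhds_iff.1 (Filter.inter_mem ht hd)
  refine ⟨K, r, hr, fun z hz => ?_⟩
  have hsub : Metric.closedBall a ‖z - a‖ ⊆ Metric.ball a r := Metric.closedBall_subset_ball hz
  -- Mean value inequality on the ball of radius `‖z - a‖`, where the Lipschitz derivative deviates
  -- from its value at `a` by at most `K * ‖z - a‖`.
  have key := (convex_closedBall a ‖z - a‖).norm_image_sub_le_of_norm_hasFDerivWithin_le'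
    (𝕜 := ℝ) (f := f) (f' := fderiv ℝ f) (φ := fderiv ℝ f a) (C := K * ‖z - a‖) (x := a) (y := z)
    (fun w hw => (hrt (hsub hw)).2.hasFDerivAt.hasFDerivWithinAt)
    (fun w hw => by
      refine (hK.norm_sub_le (hrt (hsub hw)).1 (hrt (Metric.mem_ball_self hr)).1).trans ?_
      have : ‖w - a‖ ≤ ‖z - a‖ := by simpa [dist_eq_norm] using hw
      gcongr)
    (by simp) (by simp [dist_eq_norm])
  calc _ ≤ _ := key
    _ = _ := by ring

lemma contDiffAt_cornerAngle {n : WithTop ℕ∞} :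
    ContDiffAt ℝ n (fun z : ℝ × ℝ => cornerAngle z.1 z.2) 0 := by
  unfold cornerAngle
  have h : Real.cosh (((0 : ℝ × ℝ).1 - (0 : ℝ × ℝ).2) / 2)
      - Real.exp (((0 : ℝ × ℝ).1 + (0 : ℝ × ℝ).2) / 2) / 2 = 1 / 2 := by norm_num
  refine ContDiffAt.comp (0 : ℝ × ℝ) (g := Real.arccos) ?_ ?_
  · rw [h]; exact Real.contDiffAt_arccos (by norm_num) (by norm_num)
  · have : ContDiff ℝ n (fun z : ℝ × ℝ =>
        Real.cosh ((z.1 - z.2) / 2) - Real.exp ((z.1 + z.2) / 2) / 2) := by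
      refine ContDiff.sub (Real.contDiff_cosh.comp ?_) ((Real.contDiff_exp.comp ?_).div_const 2)
      · fun_prop
      · fun_prop
    exact this.contDiffAt

/-- Computed along the line `s ↦ s • z`, with the derivative of `arccos` at `1 / 2`. Summed over the
six corners at a vertex, it gives the graph Laplacian times `1 / √3`. -/
lemma fderiv_cornerAngle_zero (z : ℝ × ℝ) :
    fderiv ℝ (fun z : ℝ × ℝ => cornerAngle z.1 z.2) 0 z = (z.1 + z.2) / (2 * √3) := by
  have hd : DifferentiableAt ℝ (fun z : ℝ × ℝ => cornerAngle z.1 z.2) 0 :=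
    (contDiffAt_cornerAngle (n := 1)).differentiableAt (by norm_num)
  have hline : HasDerivAt (fun s : ℝ => s • z) z 0 := by
    simpa using (hasDerivAt_id (0 : ℝ)).smul_const z
  have h1 : HasDerivAt (fun s : ℝ => cornerAngle (s * z.1) (s * z.2))
      (fderiv ℝ (fun z : ℝ × ℝ => cornerAngle z.1 z.2) 0 z) 0 := by
    have := HasFDerivAt.comp_hasDerivAt (0 : ℝ) (f := fun s : ℝ => s • z) (by
      simpa using hd.hasFDerivAt) hline
    simpa [Function.comp_def] using this
  have hc : HasDerivAt (fun s : ℝ => Real.cosh ((s * z.1 - s * z.2) / 2)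
      - Real.exp ((s * z.1 + s * z.2) / 2) / 2) (-(z.1 + z.2) / 4) 0 := by
    have e1 : HasDerivAt (fun s : ℝ => (s * z.1 - s * z.2) / 2) ((z.1 - z.2) / 2) 0 := by
      simpa using (((hasDerivAt_id (0 : ℝ)).mul_const z.1).sub
        ((hasDerivAt_id (0 : ℝ)).mul_const z.2)).div_const 2
    have e2 : HasDerivAt (fun s : ℝ => (s * z.1 + s * z.2) / 2) ((z.1 + z.2) / 2) 0 := by
      simpa using (((hasDerivAt_id (0 : ℝ)).mul_const z.1).add
        ((hasDerivAt_id (0 : ℝ)).mul_const z.2)).div_const 2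
    refine (e1.cosh.sub (e2.exp.div_const 2)).congr_deriv ?_
    simp
    ring
  have h2 : HasDerivAt (fun s : ℝ => cornerAngle (s * z.1) (s * z.2))
      (-(1 / √(1 - (1 / 2) ^ 2)) * (-(z.1 + z.2) / 4)) 0 := by
    unfold cornerAngle
    refine HasDerivAt.comp (0 : ℝ) (h₂ := Real.arccos) ?_ hc
    have h : Real.cosh ((0 * z.1 - 0 * z.2) / 2) - Real.exp ((0 * z.1 + 0 * z.2) / 2) / 2
      = (1 / 2 : ℝ) := by norm_num
    rw [h]
    exact Real.hasDerivAt_arccos (by norm_num) (by norm_num)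
  rw [h1.unique h2]
  have : √(1 - (1 / 2) ^ 2) = √3 / 2 := by
    rw [show (1 - (1 / 2 : ℝ) ^ 2) = 3 / 2 ^ 2 by norm_num, Real.sqrt_div (by norm_num),
      Real.sqrt_sq (by norm_num)]
  rw [this]
  have : √3 ≠ 0 := by positivity
  field_simp
  ring

/-- Near the regular triangle the angle is Lipschitz, and linear up to a quadratic error. -/
lemma exists_cornerAngle_bounds : ∃ K > 0, ∃ r > 0,
    (∀ x y x' y' : ℝ, |x| ≤ r → |y| ≤ r → |x'| ≤ r → |y'| ≤ r →
      |cornerAngle x y - cornerAngle x' y'| ≤ K * (|x - x'| + |y - y'|)) ∧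
    (∀ x y : ℝ, |x| ≤ r → |y| ≤ r →
      |cornerAngle x y - Real.pi / 3 - (x + y) / (2 * √3)| ≤ K * (x ^ 2 + y ^ 2)) := by
  obtain ⟨K₁, t, ht, hK₁⟩ := (contDiffAt_cornerAngle (n := 1)).exists_lipschitzOnWith
  obtain ⟨K₂, r₂, hr₂, hK₂⟩ := (contDiffAt_cornerAngle (n := 2)).exists_quadratic_remainder
  obtain ⟨r₁, hr₁, hrt⟩ := Metric.mem_nhds_iff.1 ht
  have hr : 0 < min r₁ r₂ / 2 := by positivity
  have hmem : ∀ x y : ℝ, |x| ≤ min r₁ r₂ / 2 → |y| ≤ min r₁ r₂ / 2 →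
      ‖((x, y) : ℝ × ℝ)‖ < min r₁ r₂ := fun x y hx hy => by
    rw [Prod.norm_def, max_lt_iff, Real.norm_eq_abs, Real.norm_eq_abs]
    constructor <;> linarith
  refine ⟨max (K₁ : ℝ) |K₂| + 1, by positivity, _, hr, fun x y x' y' hx hy hx' hy' => ?_,
    fun x y hx hy => ?_⟩
  · have h1 : ((x, y) : ℝ × ℝ) ∈ t := hrt (by simpa using (hmem x y hx hy).trans_le (min_le_left _ _))
    have h2 : ((x', y') : ℝ × ℝ) ∈ t :=
      hrt (by simpa using (hmem x' y' hx' hy').trans_le (min_le_left _ _))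
    have := hK₁.norm_sub_le h1 h2
    rw [Real.norm_eq_abs] at this
    refine this.trans ?_
    have hn : ‖((x, y) : ℝ × ℝ) - (x', y')‖ ≤ |x - x'| + |y - y'| := by
      rw [Prod.norm_def, max_le_iff]
      simp
    gcongr
    linarith [le_max_left (K₁ : ℝ) |K₂|]
  · have h1 := hK₂ (x, y) (by simpa using (hmem x y hx hy).trans_le (min_le_right _ _))
    simp only [sub_zero, fderiv_cornerAngle_zero, Prod.fst_zero, Prod.snd_zero,
      cornerAngle_zero, Real.norm_eq_abs] at h1
    refine h1.trans ?_
    have hn : ‖((x, y) : ℝ × ℝ)‖ ^ 2 ≤ x ^ 2 + y ^ 2 := by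
      rw [Prod.norm_def]
      rcases max_cases ‖x‖ ‖y‖ with h | h <;> rw [h.1, Real.norm_eq_abs, sq_abs] <;> nlinarith
    have hK : K₂ ≤ max (K₁ : ℝ) |K₂| + 1 := by
      linarith [le_max_right (K₁ : ℝ) |K₂|, le_abs_self K₂]
    gcongr

/-! ### The flow field in terms of lattice directions -/

/-- The six unit vectors of the lattice, in cyclic order. -/
def hexDir : Fin 6 → HexVertex := ![(1, 0), (0, 1), (-1, 1), (-1, 0), (0, -1), (1, -1)]

/-- The right-hand side of the combinatorial Yamabe flow. -/
noncomputable def flowField (u : HexVertex → ℝ) (i : HexVertex) : ℝ :=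
  ∑ m : Fin 6, (cornerAngle (u (i + hexDir m) - u i) (u (i + hexDir (m + 1)) - u i) - Real.pi / 3)

lemma hexGraph_adj_iff {i j : HexVertex} : hexGraph.Adj i j ↔ ∃ m, j - i = hexDir m := by
  simp [hexGraph, Fin.exists_fin_succ, hexDir]

lemma innerAngle_conformalChange (u : HexVertex → ℝ) (i j k : HexVertex) :
    innerAngle (conformalChange u regularMetric) i j k = cornerAngle (u j - u i) (u k - u i) := by
  unfold innerAngle cornerAngle conformalChange regularMetric
  congr 1
  rw [Real.cosh_eq]
  have h : ∀ a b : ℝ, Real.exp ((a + b) / 2) = Real.exp (a / 2) * Real.exp (b / 2) := by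
    intro a b; rw [← Real.exp_add]; congr 1; ring
  have hs : ∀ a b : ℝ, Real.exp ((a - b) / 2) = Real.exp (a / 2) / Real.exp (b / 2) := by
    intro a b; rw [← Real.exp_sub]; congr 1; ring
  have e1 : (u j - u i - (u k - u i)) / 2 = (u j - u k) / 2 := by ring
  have e2 : -((u j - u k) / 2) = (u k - u j) / 2 := by ring
  rw [e1, e2, h, h, h, h, hs, hs, hs, hs]
  have h1 := (Real.exp_pos (u i / 2)).ne'
  have h2 := (Real.exp_pos (u j / 2)).ne'
  have h3 := (Real.exp_pos (u k / 2)).ne'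
  field_simp

/-- The pairs of directions that span the faces at a vertex. -/
def hexFacePairs : Finset (HexVertex × HexVertex) :=
  (Finset.univ.image fun m : Fin 6 => (hexDir m, hexDir (m + 1))) ∪
    Finset.univ.image fun m : Fin 6 => (hexDir (m + 1), hexDir m)

lemma exists_face_of_hexDir : ∀ m n : Fin 6, (∃ p, hexDir n - hexDir m = hexDir p) →
    (hexDir m, hexDir n) ∈ hexFacePairs := by
  decide

lemma hexDir_neg : ∀ m : Fin 6, ∃ n, -hexDir m = hexDir n := by decide

lemma hexDir_succ_sub : ∀ m : Fin 6, ∃ n, hexDir (m + 1) - hexDir m = hexDir n := by decide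

lemma hexDir_sub_succ : ∀ m : Fin 6, ∃ n, hexDir m - hexDir (m + 1) = hexDir n := by decide

lemma setOf_isHexFace (i : HexVertex) :
    {p : HexVertex × HexVertex | IsHexFace i p.1 p.2}
      = (fun q : HexVertex × HexVertex => (i + q.1, i + q.2)) '' (hexFacePairs : Set _) := by
  ext ⟨j, k⟩
  simp only [Set.mem_ofPred_eq, Set.mem_image, Finset.mem_coe, IsHexFace, hexGraph_adj_iff]
  constructor
  · rintro ⟨⟨m, hm⟩, ⟨p, hp⟩, ⟨n, hn⟩⟩
    obtain ⟨n', hn'⟩ := hexDir_neg n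
    have hk : k - i = hexDir n' := by rw [← hn', ← hn]; abel
    refine ⟨(hexDir m, hexDir n'), exists_face_of_hexDir m n' ⟨p, ?_⟩, ?_⟩
    · rw [← hp, ← hk, ← hm]; abel
    · rw [← hk, ← hm]; simp
  · rintro ⟨⟨a, b⟩, hab, heq⟩
    simp only [hexFacePairs, Finset.mem_union, Finset.mem_image, Finset.mem_univ, true_and,
      Prod.mk.injEq] at hab heq
    obtain ⟨rfl, rfl⟩ := heq
    have hneg : ∀ c : HexVertex, i - (i + c) = -c := fun c => by abel
    simp only [add_sub_cancel_left, add_sub_add_left_eq_sub, hneg]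
    rcases hab with ⟨m, rfl, rfl⟩ | ⟨m, rfl, rfl⟩
    · exact ⟨⟨_, rfl⟩, hexDir_succ_sub m, hexDir_neg _⟩
    · exact ⟨⟨_, rfl⟩, hexDir_sub_succ m, hexDir_neg _⟩

lemma sum_hexFacePairs (f : HexVertex × HexVertex → ℝ) :
    ∑ q ∈ hexFacePairs, f q =
      ∑ m : Fin 6, f (hexDir m, hexDir (m + 1)) + ∑ m : Fin 6, f (hexDir (m + 1), hexDir m) := by
  rw [hexFacePairs, Finset.sum_union (by decide), Finset.sum_image, Finset.sum_image]
  · intro a _ b _; revert a b; decide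
  · intro a _ b _; revert a b; decide

/-- The two orderings of a face contribute equally by `cornerAngle_comm`, which cancels the factor
`1 / 2`; the `2π` is spread as `π / 3` over six corners. -/
lemma neg_discreteCurvature (u : HexVertex → ℝ) (i : HexVertex) :
    -discreteCurvature (conformalChange u regularMetric) i = flowField u i := by
  have hinj : Function.Injective
      (fun q : HexVertex × HexVertex => (i + q.1, i + q.2)) := fun a b h => by
    simpa [Prod.ext_iff] using h
  rw [discreteCurvature, setOf_isHexFace, finsum_mem_image hinj.injOn, finsum_mem_coe_finset,
    sum_hexFacePairs, flowField]
  simp only [innerAngle_conformalChange]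
  simp_rw [fun m : Fin 6 => cornerAngle_comm (u (i + hexDir (m + 1)) - u i)
    (u (i + hexDir m) - u i)]
  rw [Finset.sum_sub_distrib]
  simp
  ring

/-- Valid for every `u`, because `arccos` takes values in `[0, π]`. This speed bound confines an
arbitrary competing solution in the uniqueness proof. -/
lemma abs_flowField_le (u : HexVertex → ℝ) (i : HexVertex) :
    |flowField u i| ≤ 6 * Real.pi := by
  unfold flowField
  refine (Finset.abs_sum_le_sum_abs _ _).trans ((Finset.sum_le_sum fun m _ =>
    (abs_le.2 ⟨?_, ?_⟩ : _ ≤ Real.pi)).trans_eq (by simp))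
  · linarith [cornerAngle_nonneg (u (i + hexDir m) - u i) (u (i + hexDir (m + 1)) - u i),
      Real.pi_pos]
  · linarith [cornerAngle_le_pi (u (i + hexDir m) - u i) (u (i + hexDir (m + 1)) - u i),
      Real.pi_pos]

/-- A conformal factor that is uniformly close to zero gives a PL metric. -/
lemma isPLMetric_conformalChange {u : HexVertex → ℝ} (hu : ∀ i, |u i| ≤ 1 / 4) :
    IsPLMetric (conformalChange u regularMetric) where
  symm i j _ := by simp [conformalChange, regularMetric, add_comm]
  pos i j _ := by simp [conformalChange, regularMetric, Real.exp_pos]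
  triangle i j k _ := by
    simp only [conformalChange, regularMetric, mul_one]
    have h1 := abs_le.1 (hu i)
    have h2 := abs_le.1 (hu j)
    have h3 := abs_le.1 (hu k)
    have a1 : Real.exp ((u i + u j) / 2) ≤ Real.exp (1 / 4) := Real.exp_le_exp.2 (by linarith)
    have a2 : Real.exp (1 / 4) < 3 / 2 := by
      have := Real.exp_bound_div_one_sub_of_interval (x := 1 / 4) (by norm_num) (by norm_num)
      linarith
    -- Two sides add up to at least `3 / 2`, and the third is at most `exp (1 / 4) < 3 / 2`.
    linarith [Real.add_one_le_exp ((u i + u k) / 2), Real.add_one_le_exp ((u k + u j) / 2)]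

/-! ### Tools for ordinary differential equations in a Banach space -/

section RadialRetraction

variable {E : Type*} [NormedAddCommGroup E] [NormedSpace ℝ E]

/-- The radial retraction onto the closed ball of radius `r` about the origin. -/
noncomputable def radialRetraction (r : ℝ) (x : E) : E := (r / max r ‖x‖) • x

lemma radialRetraction_of_norm_le {r : ℝ} (hr : 0 < r) {x : E} (hx : ‖x‖ ≤ r) :
    radialRetraction r x = x := by
  rw [radialRetraction, max_eq_left hx, div_self hr.ne', one_smul]

lemma norm_radialRetraction_le {r : ℝ} (hr : 0 < r) (x : E) : ‖radialRetraction r x‖ ≤ r := by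
  have hm : 0 < max r ‖x‖ := lt_max_of_lt_left hr
  rw [radialRetraction, norm_smul, Real.norm_of_nonneg (by positivity), div_mul_eq_mul_div,
    div_le_iff₀ hm]
  gcongr
  exact le_max_right _ _

lemma norm_radialRetraction_sub_le {r : ℝ} (hr : 0 < r) (x y : E) :
    ‖radialRetraction r x - radialRetraction r y‖ ≤ 2 * ‖x - y‖ := by
  have hx : 0 < max r ‖x‖ := lt_max_of_lt_left hr
  have hy : 0 < max r ‖y‖ := lt_max_of_lt_left hr
  have hmax : |max r ‖y‖ - max r ‖x‖| ≤ ‖x - y‖ := by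
    have h1 := abs_max_sub_max_le_abs ‖y‖ ‖x‖ r
    rw [max_comm, max_comm ‖x‖] at h1
    exact h1.trans (by rw [abs_sub_comm]; exact abs_norm_sub_norm_le x y)
  -- First move the vector with the scaling factor fixed, then change the factor; each part costs at
  -- most `‖x - y‖`, whence the constant `2`.
  have key : radialRetraction r x - radialRetraction r y
      = (r / max r ‖x‖) • (x - y) + ((r / max r ‖x‖) * ((max r ‖y‖ - max r ‖x‖) / max r ‖y‖)) • y := by
    unfold radialRetraction
    rw [smul_sub, sub_add, ← sub_smul]
    congr 2
    field_simp
    ring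
  have h1 : r / max r ‖x‖ ≤ 1 := (div_le_one hx).2 (le_max_left _ _)
  have h0 : 0 ≤ r / max r ‖x‖ := by positivity
  have h2 : ‖((r / max r ‖x‖) * ((max r ‖y‖ - max r ‖x‖) / max r ‖y‖)) • y‖ ≤ ‖x - y‖ := by
    rw [norm_smul, norm_mul, norm_div (max r ‖y‖ - _), Real.norm_of_nonneg h0,
      Real.norm_of_nonneg hy.le, Real.norm_eq_abs, mul_assoc]
    calc _ ≤ 1 * (|max r ‖y‖ - max r ‖x‖| / max r ‖y‖ * max r ‖y‖) := by
          gcongr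
          exact le_max_right _ _
      _ ≤ _ := by rw [div_mul_cancel₀ _ hy.ne', one_mul]; exact hmax
  have h3 : ‖(r / max r ‖x‖) • (x - y)‖ ≤ ‖x - y‖ := by
    rw [norm_smul, Real.norm_of_nonneg h0]
    exact mul_le_of_le_one_left (norm_nonneg _) h1
  rw [key]
  linarith [norm_add_le ((r / max r ‖x‖) • (x - y))
    (((r / max r ‖x‖) * ((max r ‖y‖ - max r ‖x‖) / max r ‖y‖)) • y)]

end RadialRetraction

/-- A bounded Lipschitz vector field on a Banach space has an integral curve on `[0, ∞)` through
every point. -/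
lemma exists_forward_integralCurve {E : Type*} [NormedAddCommGroup E] [NormedSpace ℝ E]
    [CompleteSpace E] {G : E → E} {K M : NNReal} (hG : LipschitzWith K G) (hM : ∀ x, ‖G x‖ ≤ M)
    (x₀ : E) : ∃ α : ℝ → E, α 0 = x₀ ∧
      ∀ t, 0 ≤ t → HasDerivWithinAt α (G (α t)) (Set.Ici 0) t := by
  have hloc : ∀ n : ℕ, ∃ α : ℝ → E, α 0 = x₀ ∧
      ∀ t ∈ Set.Icc (0 : ℝ) n, HasDerivWithinAt α (G (α t)) (Set.Icc 0 n) t := fun n => by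
    -- The field is bounded by `M` everywhere, so the ball of radius `M * n` contains the curve up
    -- to time `n` and the interval need not be short.
    have hPL : IsPicardLindelof (fun _ => G) (tmin := 0) (tmax := n) ⟨0, by simp⟩ x₀
        (M * n) 0 M K :=
      { lipschitzOnWith := fun _ _ => hG.lipschitzOnWith
        continuousOn := fun _ _ => continuousOn_const
        norm_le := fun _ _ x _ => hM x
        mul_max_le := by simp }
    exact hPL.exists_eq_forall_mem_Icc_hasDerivWithinAt₀
  choose α hα0 hα using hloc
  have huniq : ∀ n m : ℕ, n ≤ m → ∀ t ∈ Set.Icc (0 : ℝ) n, α n t = α m t := fun n m hnm => by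
    have hsub : Set.Icc (0 : ℝ) n ⊆ Set.Icc 0 m := Set.Icc_subset_Icc_right (by exact_mod_cast hnm)
    refine ODE_solution_unique_of_mem_Icc_right (v := fun _ => G) (s := fun _ => Set.univ)
      (K := K) (fun _ _ => hG.lipschitzOnWith)
      (fun t ht => (hα n t ht).continuousWithinAt)
      (fun t ht => ((hα n t ⟨ht.1, ht.2.le⟩).mono_of_mem_nhdsWithin
        (Icc_mem_nhdsGE_of_mem ht))) (fun _ _ => trivial)
      (fun t ht => ((hα m t (hsub ht)).mono hsub).continuousWithinAt)
      (fun t ht => (((hα m t (hsub ⟨ht.1, ht.2.le⟩)).mono hsub).mono_of_mem_nhdsWithin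
        (Icc_mem_nhdsGE_of_mem ht))) (fun _ _ => trivial) (by rw [hα0, hα0])
  have hval : ∀ n : ℕ, ∀ t ∈ Set.Icc (0 : ℝ) n, α (⌈t⌉₊ + 1) t = α n t := fun n t ht => by
    have htc : t ∈ Set.Icc (0 : ℝ) ((⌈t⌉₊ + 1 : ℕ) : ℝ) :=
      ⟨ht.1, (Nat.le_ceil t).trans (by push_cast; linarith)⟩
    rcases le_total n (⌈t⌉₊ + 1) with h | h
    · exact (huniq _ _ h t ht).symm
    · exact huniq _ _ h t htc
  refine ⟨fun t => α (⌈t⌉₊ + 1) t, hα0 _, fun t ht => ?_⟩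
  obtain ⟨n, hn⟩ := exists_nat_gt t
  have htn : t ∈ Set.Icc (0 : ℝ) n := ⟨ht, hn.le⟩
  have h1 : HasDerivWithinAt (fun t => α (⌈t⌉₊ + 1) t) (G (α n t)) (Set.Icc 0 n) t :=
    (hα n t htn).congr (fun s hs => hval n s hs) (hval n t htn)
  simp only [hval n t htn]
  refine h1.mono_of_mem_nhdsWithin ?_
  rw [← Set.Ici_inter_Iic]
  exact Filter.inter_mem self_mem_nhdsWithin (mem_nhdsWithin_of_mem_nhds (Iic_mem_nhds hn))

/-- One-sided mean value inequality on `[0, ∞)`. -/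
lemma sub_le_mul_sub_of_hasDerivWithinAt_Ici {f f' : ℝ → ℝ}
    (hf : ∀ t, 0 ≤ t → HasDerivWithinAt f (f' t) (Set.Ici 0) t) {a b C : ℝ} (ha : 0 ≤ a)
    (hab : a ≤ b) (hC : ∀ t ∈ Set.Icc a b, f' t ≤ C) : f b - f a ≤ C * (b - a) := by
  have hderiv : ∀ t ∈ interior (Set.Icc a b), HasDerivAt f (f' t) t := fun t ht => by
    rw [interior_Icc] at ht
    exact (hf t (ha.trans ht.1.le)).hasDerivAt (Ici_mem_nhds (ha.trans_lt ht.1))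
  refine (convex_Icc a b).image_sub_le_mul_sub_of_deriv_le
    (fun t ht => ((hf t (ha.trans ht.1)).continuousWithinAt).mono
      (fun s hs => ha.trans hs.1))
    (fun t ht => (hderiv t ht).differentiableAt.differentiableWithinAt)
    (fun t ht => ?_) a (Set.left_mem_Icc.2 hab) b (Set.right_mem_Icc.2 hab) hab
  rw [(hderiv t ht).deriv]
  exact hC t (interior_subset ht)

/-- Mean value inequality on `[0, ∞)`. -/
lemma norm_sub_le_of_hasDerivWithinAt_Ici {E : Type*} [NormedAddCommGroup E] [NormedSpace ℝ E]
    {f f' : ℝ → E} (hf : ∀ t, 0 ≤ t → HasDerivWithinAt f (f' t) (Set.Ici 0) t) {a b C : ℝ}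
    (ha : 0 ≤ a) (hab : a ≤ b) (hC : ∀ t ∈ Set.Icc a b, ‖f' t‖ ≤ C) :
    ‖f b - f a‖ ≤ C * (b - a) := by
  have := (convex_Icc a b).norm_image_sub_le_of_norm_hasDerivWithin_le
    (fun t ht => (hf t (ha.trans ht.1)).mono (fun s hs => ha.trans hs.1)) hC
    (Set.left_mem_Icc.2 hab) (Set.right_mem_Icc.2 hab)
  rwa [Real.norm_of_nonneg (sub_nonneg.2 hab)] at this

/-! ### Lipschitz estimates for the flow field, in the sup norm and in `ℓ²` -/

/-- The angle function is Lipschitz on the square of side `2 r` with constant `K`, and agrees there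
with its linearization up to the error `K (x² + y²)`. -/
structure CornerAngleBounds (K r : ℝ) : Prop where
  K_pos : 0 < K
  r_pos : 0 < r
  lipschitz : ∀ x y x' y' : ℝ, |x| ≤ r → |y| ≤ r → |x'| ≤ r → |y'| ≤ r →
    |cornerAngle x y - cornerAngle x' y'| ≤ K * (|x - x'| + |y - y'|)
  quadratic : ∀ x y : ℝ, |x| ≤ r → |y| ≤ r →
    |cornerAngle x y - Real.pi / 3 - (x + y) / (2 * √3)| ≤ K * (x ^ 2 + y ^ 2)

lemma flowField_zero (i : HexVertex) : flowField 0 i = 0 := by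
  simp [flowField, cornerAngle_zero]

lemma sum_hexDir_succ (f : HexVertex → ℝ) :
    ∑ m : Fin 6, f (hexDir (m + 1)) = ∑ m : Fin 6, f (hexDir m) :=
  Equiv.sum_comp (Equiv.addRight (1 : Fin 6)) fun m => f (hexDir m)

lemma CornerAngleBounds.abs_flowField_sub_le {K r : ℝ} (h : CornerAngleBounds K r)
    {u v : HexVertex → ℝ} (hu : ∀ i, |u i| ≤ r / 2) (hv : ∀ i, |v i| ≤ r / 2) (i : HexVertex) :
    |flowField u i - flowField v i| ≤
      K * (2 * ∑ m : Fin 6, |u (i + hexDir m) - v (i + hexDir m)| + 12 * |u i - v i|) := by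
  have hd : ∀ {w : HexVertex → ℝ}, (∀ i, |w i| ≤ r / 2) → ∀ j, |w j - w i| ≤ r :=
    fun {w} hw j => by linarith [abs_sub (w j) (w i), hw i, hw j]
  have hterm : ∀ m : Fin 6,
      |(cornerAngle (u (i + hexDir m) - u i) (u (i + hexDir (m + 1)) - u i) - Real.pi / 3)
        - (cornerAngle (v (i + hexDir m) - v i) (v (i + hexDir (m + 1)) - v i) - Real.pi / 3)|
      ≤ K * (|u (i + hexDir m) - v (i + hexDir m)|
        + |u (i + hexDir (m + 1)) - v (i + hexDir (m + 1))| + 2 * |u i - v i|) := fun m => by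
    rw [sub_sub_sub_cancel_right]
    refine (h.lipschitz _ _ _ _ (hd hu _) (hd hu _) (hd hv _) (hd hv _)).trans ?_
    have e : ∀ j, |u j - u i - (v j - v i)| ≤ |u j - v j| + |u i - v i| := fun j => by
      rw [show u j - u i - (v j - v i) = (u j - v j) - (u i - v i) by ring]
      exact abs_sub _ _
    refine mul_le_mul_of_nonneg_left ?_ h.K_pos.le
    linarith [e (i + hexDir m), e (i + hexDir (m + 1))]
  unfold flowField
  rw [← Finset.sum_sub_distrib]
  refine (Finset.abs_sum_le_sum_abs _ _).trans ((Finset.sum_le_sum fun m _ => hterm m).trans_eq ?_)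
  rw [← Finset.mul_sum, Finset.sum_add_distrib, Finset.sum_add_distrib,
    sum_hexDir_succ fun d => |u (i + d) - v (i + d)|]
  simp only [Finset.sum_const, Finset.card_univ, Fintype.card_fin, nsmul_eq_mul]
  push_cast
  ring

lemma CornerAngleBounds.abs_flowField_sub_le_of_forall_abs_le {K r : ℝ}
    (h : CornerAngleBounds K r) {u v : HexVertex → ℝ} (hu : ∀ i, |u i| ≤ r / 2)
    (hv : ∀ i, |v i| ≤ r / 2) {M : ℝ} (hM : ∀ i, |u i - v i| ≤ M) (i : HexVertex) :
    |flowField u i - flowField v i| ≤ 24 * K * M := by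
  refine (h.abs_flowField_sub_le hu hv i).trans ?_
  have h1 : ∑ m : Fin 6, |u (i + hexDir m) - v (i + hexDir m)| ≤ 6 * M :=
    (Finset.sum_le_sum fun m _ => hM _).trans_eq (by simp)
  calc _ ≤ K * (2 * (6 * M) + 12 * M) := by
        have := h.K_pos.le
        gcongr
        exact hM i
    _ = _ := by ring

/-- The Hilbert space `ℓ²(V_H)`. -/
abbrev HexL2 : Type := lp (fun _ : HexVertex => ℝ) 2

lemma memℓp_two_iff {f : HexVertex → ℝ} : Memℓp f 2 ↔ Summable fun i => f i ^ 2 := by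
  rw [memℓp_gen_iff (by simp)]
  simp

lemma HexL2.summable_sq (f : HexL2) : Summable fun i => f i ^ 2 := memℓp_two_iff.1 f.2

lemma HexL2.norm_sq (f : HexL2) : ‖f‖ ^ 2 = ∑' i, f i ^ 2 := by
  have := lp.norm_rpow_eq_tsum (p := 2) (by simp) f
  simpa using this

lemma HexL2.abs_le_norm (f : HexL2) (i : HexVertex) : |f i| ≤ ‖f‖ := by
  simpa using lp.norm_apply_le_norm (by simp) f i

lemma summable_shift {f : HexVertex → ℝ} (hf : Summable f) (d : HexVertex) :
    Summable fun i => f (i + d) :=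
  (Equiv.addRight d).summable_iff.2 hf

lemma tsum_shift (f : HexVertex → ℝ) (d : HexVertex) : ∑' i, f (i + d) = ∑' i, f i :=
  (Equiv.addRight d).tsum_eq f

lemma hasSum_shift_sq (f : HexL2) (d : HexVertex) :
    HasSum (fun i => f (i + d) ^ 2) (‖f‖ ^ 2) := by
  rw [f.norm_sq, ← tsum_shift (fun i => f i ^ 2) d]
  exact (summable_shift f.summable_sq d).hasSum

lemma hasSum_sq (f : HexL2) : HasSum (fun i => f i ^ 2) (‖f‖ ^ 2) := by
  simpa using hasSum_shift_sq f 0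

lemma CornerAngleBounds.sq_flowField_sub_le {K r : ℝ} (h : CornerAngleBounds K r)
    {u v : HexVertex → ℝ} (hu : ∀ i, |u i| ≤ r / 2) (hv : ∀ i, |v i| ≤ r / 2) (i : HexVertex) :
    (flowField u i - flowField v i) ^ 2 ≤
      K ^ 2 * (48 * ∑ m : Fin 6, (u (i + hexDir m) - v (i + hexDir m)) ^ 2
        + 288 * (u i - v i) ^ 2) := by
  have h1 := h.abs_flowField_sub_le hu hv i
  have h2 : (∑ m : Fin 6, |u (i + hexDir m) - v (i + hexDir m)|) ^ 2
      ≤ 6 * ∑ m : Fin 6, (u (i + hexDir m) - v (i + hexDir m)) ^ 2 := by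
    have := sq_sum_le_card_mul_sum_sq (s := Finset.univ)
      (f := fun m : Fin 6 => |u (i + hexDir m) - v (i + hexDir m)|)
    simpa using this
  set S := ∑ m : Fin 6, |u (i + hexDir m) - v (i + hexDir m)|
  set Q := ∑ m : Fin 6, (u (i + hexDir m) - v (i + hexDir m)) ^ 2
  rw [← sq_abs]
  calc _ ≤ (K * (2 * S + 12 * |u i - v i|)) ^ 2 := by gcongr
    _ = K ^ 2 * (2 * S + 12 * |u i - v i|) ^ 2 := by ring
    _ ≤ _ := by
      gcongr
      nlinarith [sq_nonneg (2 * S - 12 * |u i - v i|), sq_abs (u i - v i)]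

/-- Shifts preserve the norm, and `48 * 6 + 288 = 24 ^ 2`; so the `ℓ²` Lipschitz constant `24 * K`
is the same as the sup-norm one. -/
lemma hasSum_shifts_sq (w : HexL2) :
    HasSum (fun i => 48 * ∑ m : Fin 6, w (i + hexDir m) ^ 2 + 288 * w i ^ 2)
      (576 * ‖w‖ ^ 2) := by
  have h1 := (hasSum_sum (s := Finset.univ) fun (m : Fin 6) _ => hasSum_shift_sq w (hexDir m))
  have h2 := (h1.mul_left 48).add ((hasSum_sq w).mul_left 288)
  rwa [Finset.sum_const, Finset.card_univ, Fintype.card_fin, nsmul_eq_mul,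
    show 48 * (((6 : ℕ) : ℝ) * ‖w‖ ^ 2) + 288 * ‖w‖ ^ 2 = 576 * ‖w‖ ^ 2 by push_cast; ring] at h2

lemma CornerAngleBounds.memℓp_flowField_sub {K r : ℝ} (h : CornerAngleBounds K r)
    {u v : HexL2} (hu : ∀ i, |u i| ≤ r / 2) (hv : ∀ i, |v i| ≤ r / 2) :
    Memℓp (fun i => flowField u i - flowField v i) 2 := by
  rw [memℓp_two_iff]
  exact Summable.of_nonneg_of_le (fun i => sq_nonneg _) (fun i => h.sq_flowField_sub_le hu hv i)
    ((hasSum_shifts_sq (u - v)).mul_left (K ^ 2)).summable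

lemma CornerAngleBounds.memℓp_flowField {K r : ℝ} (h : CornerAngleBounds K r)
    {u : HexL2} (hu : ∀ i, |u i| ≤ r / 2) : Memℓp (flowField u) 2 := by
  have hr := h.r_pos
  have h1 := h.memℓp_flowField_sub (v := 0) hu (fun i => by simp; positivity)
  have h2 : (fun i => flowField u i - flowField (0 : HexL2) i) = flowField u :=
    funext fun i => (congrArg _ (flowField_zero i)).trans (sub_zero _)
  rwa [h2] at h1

open Classical in
/-- The right-hand side of the flow as a vector field on `ℓ²(V_H)`; it is set to zero where
`flowField u` is not square summable. -/
noncomputable def l2Field (u : HexL2) : HexL2 :=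
  if h : Memℓp (flowField u) 2 then ⟨flowField u, h⟩ else 0

lemma CornerAngleBounds.l2Field_apply {K r : ℝ} (h : CornerAngleBounds K r)
    {u : HexL2} (hu : ‖u‖ ≤ r / 2) (i : HexVertex) : l2Field u i = flowField u i := by
  rw [l2Field, dif_pos (h.memℓp_flowField fun i => (u.abs_le_norm i).trans hu)]

lemma CornerAngleBounds.norm_l2Field_sub_le {K r : ℝ} (h : CornerAngleBounds K r)
    {u v : HexL2} (hu : ‖u‖ ≤ r / 2) (hv : ‖v‖ ≤ r / 2) :
    ‖l2Field u - l2Field v‖ ≤ 24 * K * ‖u - v‖ := by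
  have hK := h.K_pos
  refine le_of_sq_le_sq ?_ (by positivity)
  have h1 := hasSum_le (fun i => ?_) (hasSum_sq (l2Field u - l2Field v))
    ((hasSum_shifts_sq (u - v)).mul_left (K ^ 2))
  · calc _ ≤ _ := h1
      _ = _ := by ring
  · have := h.sq_flowField_sub_le (fun i => (u.abs_le_norm i).trans hu)
      (fun i => (v.abs_le_norm i).trans hv) i
    simpa [h.l2Field_apply hu, h.l2Field_apply hv] using this

lemma CornerAngleBounds.norm_l2Field_le {K r : ℝ} (h : CornerAngleBounds K r)
    {u : HexL2} (hu : ‖u‖ ≤ r / 2) : ‖l2Field u‖ ≤ 24 * K * ‖u‖ := by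
  have hr := h.r_pos
  have h0 : l2Field 0 = 0 := by
    ext i
    rw [h.l2Field_apply (by simp; positivity)]
    exact flowField_zero i
  simpa [h0] using h.norm_l2Field_sub_le hu (v := 0) (by simp; positivity)

/-! ### The Dirichlet energy as a sum over vertices -/

/-- The energy density at `i`: the squared differences along the three edges that leave `i` in the
directions `1`, `ω`, `ω - 1`. -/
def energyDensity (u : HexVertex → ℝ) (i : HexVertex) : ℝ :=
  (u (i + hexDir 0) - u i) ^ 2 + (u (i + hexDir 1) - u i) ^ 2 + (u (i + hexDir 2) - u i) ^ 2

lemma energyDensity_nonneg (u : HexVertex → ℝ) (i : HexVertex) : 0 ≤ energyDensity u i := by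
  unfold energyDensity
  positivity

lemma hasSum_energyDensity_bound (u : HexL2) :
    HasSum (fun i => 2 * u (i + hexDir 0) ^ 2 + 2 * u (i + hexDir 1) ^ 2
      + 2 * u (i + hexDir 2) ^ 2 + 6 * u i ^ 2) (12 * ‖u‖ ^ 2) := by
  have h := ((((hasSum_shift_sq u (hexDir 0)).mul_left 2).add
    ((hasSum_shift_sq u (hexDir 1)).mul_left 2)).add
    ((hasSum_shift_sq u (hexDir 2)).mul_left 2)).add ((hasSum_sq u).mul_left 6)
  rwa [show 2 * ‖u‖ ^ 2 + 2 * ‖u‖ ^ 2 + 2 * ‖u‖ ^ 2 + 6 * ‖u‖ ^ 2 = 12 * ‖u‖ ^ 2 by ring] at h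

lemma energyDensity_le (u : HexVertex → ℝ) (i : HexVertex) :
    energyDensity u i ≤ 2 * u (i + hexDir 0) ^ 2 + 2 * u (i + hexDir 1) ^ 2
      + 2 * u (i + hexDir 2) ^ 2 + 6 * u i ^ 2 := by
  unfold energyDensity
  nlinarith [sq_nonneg (u (i + hexDir 0) + u i), sq_nonneg (u (i + hexDir 1) + u i),
    sq_nonneg (u (i + hexDir 2) + u i)]

lemma summable_energyDensity (u : HexL2) : Summable (energyDensity u) :=
  (hasSum_energyDensity_bound u).summable.of_nonneg_of_le (energyDensity_nonneg u)
    (energyDensity_le u)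

/-- The Dirichlet energy on `ℓ²(V_H)`, as a sum over vertices. -/
noncomputable def l2Energy (u : HexL2) : ℝ := ∑' i, energyDensity u i

lemma l2Energy_nonneg (u : HexL2) : 0 ≤ l2Energy u := tsum_nonneg (energyDensity_nonneg u)

lemma l2Energy_le (u : HexL2) : l2Energy u ≤ 12 * ‖u‖ ^ 2 :=
  hasSum_le (energyDensity_le u) (summable_energyDensity u).hasSum (hasSum_energyDensity_bound u)

/-- From `a² ≤ 2b² + 2(a - b)²` on each edge. It prevents the energy from dropping abruptly along a
Lipschitz curve. -/
lemma l2Energy_le_two_mul_add (u v : HexL2) :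
    l2Energy u ≤ 2 * l2Energy v + 24 * ‖u - v‖ ^ 2 := by
  have h := hasSum_le (fun i => ?_) (summable_energyDensity u).hasSum
    (((summable_energyDensity v).hasSum.mul_left 2).add
      ((summable_energyDensity (u - v)).hasSum.mul_left 2))
  · have h2 := l2Energy_le (u - v)
    unfold l2Energy at *
    linarith
  · simp only [energyDensity, lp.coeFn_sub, Pi.sub_apply]
    nlinarith [sq_nonneg ((u (i + hexDir 0) - u i) - 2 * (v (i + hexDir 0) - v i)),
      sq_nonneg ((u (i + hexDir 1) - u i) - 2 * (v (i + hexDir 1) - v i)),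
      sq_nonneg ((u (i + hexDir 2) - u i) - 2 * (v (i + hexDir 2) - v i))]

/-! ### Dissipation of the `ℓ²` norm -/

/-- The contribution of a single triangle to the dissipation. -/
lemma CornerAngleBounds.triangle_dissipation {K r : ℝ} (h : CornerAngleBounds K r) {ρ : ℝ}
    (hρr : ρ ≤ r / 2) (hρK : 16 * K * ρ ≤ 1) {a b c : ℝ} (ha : |a| ≤ ρ) (hb : |b| ≤ ρ)
    (hc : |c| ≤ ρ) :
    a * (cornerAngle (b - a) (c - a) - Real.pi / 3)
      + b * (cornerAngle (c - b) (a - b) - Real.pi / 3)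
      + c * (cornerAngle (a - c) (b - c) - Real.pi / 3)
      ≤ -(1 / 8) * ((b - a) ^ 2 + (c - b) ^ 2 + (a - c) ^ 2) := by
  have hK := h.K_pos
  have hρ : 0 ≤ ρ := (abs_nonneg a).trans ha
  have key : ∀ {p q s : ℝ}, |p| ≤ ρ → |q| ≤ ρ → |s| ≤ ρ →
      p * (cornerAngle (q - p) (s - p) - Real.pi / 3)
        ≤ p * ((q - p) + (s - p)) / (2 * √3) + 1 / 16 * ((q - p) ^ 2 + (s - p) ^ 2) := by
    intro p q s hp hq hs
    have h1 := h.quadratic (q - p) (s - p) (by linarith [abs_sub q p]) (by linarith [abs_sub s p])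
    set R := cornerAngle (q - p) (s - p) - Real.pi / 3 - ((q - p) + (s - p)) / (2 * √3) with hR
    have h2 : p * R ≤ ρ * (K * ((q - p) ^ 2 + (s - p) ^ 2)) :=
      (le_abs_self _).trans (by rw [abs_mul]; gcongr)
    have h3 : ρ * (K * ((q - p) ^ 2 + (s - p) ^ 2)) ≤ 1 / 16 * ((q - p) ^ 2 + (s - p) ^ 2) := by
      rw [← mul_assoc]
      gcongr
      linarith
    have h4 : p * (cornerAngle (q - p) (s - p) - Real.pi / 3)
        = p * ((q - p) + (s - p)) / (2 * √3) + p * R := by rw [hR]; ring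
    linarith
  have k1 := key ha hb hc
  have k2 := key hb hc ha
  have k3 := key hc ha hb
  have hs : 1 / 4 ≤ 1 / (2 * √3) := by
    have h3 : √3 ≤ 2 := by
      rw [Real.sqrt_le_left (by norm_num)]
      norm_num
    exact one_div_le_one_div_of_le (by positivity) (by linarith)
  -- Summation by parts on one triangle. Its coefficient is at least `1 / 4`, while the errors cost
  -- `1 / 16` twice per edge, leaving `1 / 8`.
  have hsum : a * ((b - a) + (c - a)) / (2 * √3) + b * ((c - b) + (a - b)) / (2 * √3)
      + c * ((a - c) + (b - c)) / (2 * √3)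
      = -(1 / (2 * √3)) * ((b - a) ^ 2 + (c - b) ^ 2 + (a - c) ^ 2) := by
    ring
  have hS : 1 / 4 * ((b - a) ^ 2 + (c - b) ^ 2 + (a - c) ^ 2)
      ≤ 1 / (2 * √3) * ((b - a) ^ 2 + (c - b) ^ 2 + (a - c) ^ 2) := by gcongr
  linarith

/-- The contribution at `i` of its `m`-th corner to `⟪u, flowField u⟫`. -/
noncomputable def cornerTerm (u : HexVertex → ℝ) (m : Fin 6) (i : HexVertex) : ℝ :=
  u i * (cornerAngle (u (i + hexDir m) - u i) (u (i + hexDir (m + 1)) - u i) - Real.pi / 3)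

lemma CornerAngleBounds.summable_cornerTerm {K r : ℝ} (h : CornerAngleBounds K r) {u : HexL2}
    (hu : ‖u‖ ≤ r / 2) (m : Fin 6) : Summable (cornerTerm u m) := by
  have hK := h.K_pos
  have hr := h.r_pos
  refine Summable.of_norm_bounded (g := fun i => K * (u (i + hexDir m) ^ 2
    + u (i + hexDir (m + 1)) ^ 2 + 3 * u i ^ 2))
    ((((hasSum_shift_sq u _).add (hasSum_shift_sq u _)).add
      ((hasSum_sq u).mul_left 3)).mul_left K).summable fun i => ?_
  have hd : ∀ j, |u j - u i| ≤ r := fun j => by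
    linarith [abs_sub (u j) (u i), (u.abs_le_norm i).trans hu, (u.abs_le_norm j).trans hu]
  have h1 := h.lipschitz _ _ 0 0 (hd (i + hexDir m)) (hd (i + hexDir (m + 1)))
    (by simpa using hr.le) (by simpa using hr.le)
  rw [cornerAngle_zero, sub_zero, sub_zero] at h1
  rw [cornerTerm, Real.norm_eq_abs, abs_mul]
  calc _ ≤ |u i| * (K * (|u (i + hexDir m) - u i| + |u (i + hexDir (m + 1)) - u i|)) := by gcongr
    _ ≤ |u i| * (K * (|u (i + hexDir m)| + |u i| + (|u (i + hexDir (m + 1))| + |u i|))) := by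
      gcongr <;> exact abs_sub _ _
    _ = K * (|u i| * (|u (i + hexDir m)| + |u i| + (|u (i + hexDir (m + 1))| + |u i|))) := by ring
    _ ≤ _ := by
      gcongr
      rw [← sq_abs (u (i + hexDir m)), ← sq_abs (u (i + hexDir (m + 1))), ← sq_abs (u i)]
      nlinarith [sq_nonneg (|u i| - |u (i + hexDir m)|),
        sq_nonneg (|u i| - |u (i + hexDir (m + 1))|), sq_nonneg |u (i + hexDir m)|,
        sq_nonneg |u (i + hexDir (m + 1))|]

/-- The six terms are the corners of the two faces `{0, 1, ω}` and `{0, ω, ω - 1}` translated by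
`i`. Each corner type `m` occurs once, so summing over `i` recovers the whole inner product. The
edges not in `energyDensity u i`, and a second copy of the edge in direction `ω`, are discarded. -/
lemma CornerAngleBounds.sum_cornerTerm_le {K r : ℝ} (h : CornerAngleBounds K r) {ρ : ℝ}
    (hρr : ρ ≤ r / 2) (hρK : 16 * K * ρ ≤ 1) {u : HexVertex → ℝ} (hu : ∀ i, |u i| ≤ ρ)
    (i : HexVertex) :
    cornerTerm u 0 i + cornerTerm u 2 (i + hexDir 0) + cornerTerm u 4 (i + hexDir 1)
      + (cornerTerm u 1 i + cornerTerm u 3 (i + hexDir 1) + cornerTerm u 5 (i + hexDir 2))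
      ≤ -(1 / 8) * energyDensity u i := by
  have h1 := h.triangle_dissipation hρr hρK (hu i) (hu (i + hexDir 0)) (hu (i + hexDir 1))
  have h2 := h.triangle_dissipation hρr hρK (hu i) (hu (i + hexDir 1)) (hu (i + hexDir 2))
  have e02 : hexDir 0 + hexDir 2 = hexDir 1 := by decide
  have e03 : hexDir 0 + hexDir 3 = 0 := by decide
  have e14 : hexDir 1 + hexDir 4 = 0 := by decide
  have e15 : hexDir 1 + hexDir 5 = hexDir 0 := by decide
  have e13 : hexDir 1 + hexDir 3 = hexDir 2 := by decide
  have e25 : hexDir 2 + hexDir 5 = 0 := by decide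
  have e20 : hexDir 2 + hexDir 0 = hexDir 1 := by decide
  simp only [cornerTerm, add_assoc i, Fin.isValue, zero_add,
    show (1 : Fin 6) + 1 = 2 from rfl, show (2 : Fin 6) + 1 = 3 from rfl,
    show (3 : Fin 6) + 1 = 4 from rfl, show (4 : Fin 6) + 1 = 5 from rfl,
    show (5 : Fin 6) + 1 = 0 from rfl, e02, e03, e14, e15, e13, e25, e20, add_zero]
  unfold energyDensity
  linarith [sq_nonneg (u (i + hexDir 1) - u (i + hexDir 0)),
    sq_nonneg (u (i + hexDir 2) - u (i + hexDir 1)), sq_nonneg (u (i + hexDir 1) - u i)]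

/-- The flow dissipates the `ℓ²` norm at a rate controlled by the Dirichlet energy. -/
lemma CornerAngleBounds.inner_l2Field_le {K r : ℝ} (h : CornerAngleBounds K r) {ρ : ℝ}
    (hρr : ρ ≤ r / 2) (hρK : 16 * K * ρ ≤ 1) {u : HexL2} (hu : ‖u‖ ≤ ρ) :
    inner ℝ u (l2Field u) ≤ -(1 / 8) * l2Energy u := by
  have hur := hu.trans hρr
  have hT : ∀ m, HasSum (cornerTerm u m) (∑' i, cornerTerm u m i) := fun m =>
    (h.summable_cornerTerm hur m).hasSum
  have hTs : ∀ m d, HasSum (fun i => cornerTerm u m (i + d)) (∑' i, cornerTerm u m i) :=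
    fun m d => (Equiv.addRight d).hasSum_iff.2 (hT m)
  have h1 : HasSum (fun i => ∑ m, cornerTerm u m i) (∑ m, ∑' i, cornerTerm u m i) :=
    hasSum_sum fun m _ => hT m
  have h2 : inner ℝ u (l2Field u) = ∑ m, ∑' i, cornerTerm u m i := by
    refine (lp.hasSum_inner u (l2Field u)).unique ?_
    have e : (fun i => inner ℝ (u i) (l2Field u i)) = fun i => ∑ m, cornerTerm u m i := by
      ext i
      simp only [cornerTerm, ← Finset.mul_sum]
      rw [h.l2Field_apply hur, flowField]
      exact mul_comm _ _
    rwa [e]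
  -- Each corner sum is translation invariant, so the sum over vertices may be regrouped by faces.
  have h3 := hasSum_le (h.sum_cornerTerm_le hρr hρK fun i => (u.abs_le_norm i).trans hu)
    ((((hT 0).add (hTs 2 _)).add (hTs 4 _)).add (((hT 1).add (hTs 3 _)).add (hTs 5 _)))
    ((summable_energyDensity u).hasSum.mul_left _)
  rw [h2, Fin.sum_univ_six]
  unfold l2Energy
  linarith

/-! ### From energy to sup norm, and from vertices to edges -/

/-- A discrete Agmon inequality: the supremum is controlled by the energy and the `ℓ²` norm. -/
lemma sq_le_l2Energy (u : HexL2) {η : ℝ} (hη : 0 < η) (i : HexVertex) :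
    u i ^ 2 ≤ l2Energy u / (2 * η) + 2 * η * ‖u‖ ^ 2 := by
  have hinj : Function.Injective fun k : ℕ => i + k • hexDir 0 := fun k l hkl => by
    simpa [hexDir] using hkl
  have hs := u.summable_sq.comp_injective hinj
  have hs1 := (summable_shift u.summable_sq (hexDir 0)).comp_injective hinj
  have hE := (summable_energyDensity u).comp_injective hinj
  have hsucc : ∀ k : ℕ, i + k • hexDir 0 + hexDir 0 = i + (k + 1) • hexDir 0 := fun k => by
    rw [succ_nsmul, add_assoc]
  -- Telescoping along the ray from `i` in direction `1`; square summability removes the term at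
  -- infinity.
  have htel : u i ^ 2 = ∑' k : ℕ, (u (i + k • hexDir 0) ^ 2 - u (i + k • hexDir 0 + hexDir 0) ^ 2) := by
    have h0 := hs.tsum_eq_zero_add
    have h1 := hs.tsum_sub hs1
    simp only [Function.comp_def, hsucc, zero_nsmul, add_zero] at h0 h1
    simp only [hsucc]
    linarith
  have hle := (hs.sub hs1).tsum_le_tsum (g := fun k => energyDensity u (i + k • hexDir 0) / (2 * η)
      + η * (u (i + k • hexDir 0) ^ 2 + u (i + k • hexDir 0 + hexDir 0) ^ 2)) (fun k => ?_)
      ((hE.div_const _).add ((hs.add hs1).mul_left η))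
  · have e1 : ∑' k : ℕ, energyDensity u (i + k • hexDir 0) ≤ l2Energy u :=
      tsum_comp_le_tsum_of_inj (summable_energyDensity u) (energyDensity_nonneg u) hinj
    have e2 : ∑' k : ℕ, u (i + k • hexDir 0) ^ 2 ≤ ‖u‖ ^ 2 := by
      rw [u.norm_sq]
      exact tsum_comp_le_tsum_of_inj u.summable_sq (fun _ => sq_nonneg _) hinj
    have e3 : ∑' k : ℕ, u (i + k • hexDir 0 + hexDir 0) ^ 2 ≤ ‖u‖ ^ 2 := by
      rw [u.norm_sq, ← tsum_shift _ (hexDir 0)]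
      exact tsum_comp_le_tsum_of_inj (summable_shift u.summable_sq (hexDir 0))
        (fun _ => sq_nonneg _) hinj
    have e4 := (hE.div_const (2 * η)).tsum_add ((hs.add hs1).mul_left η)
    have e5 := hs.tsum_add hs1
    simp only [Function.comp_def] at e4 e5 hle
    rw [tsum_mul_left, tsum_div_const, e5] at e4
    rw [← htel, e4] at hle
    refine hle.trans ?_
    calc _ ≤ l2Energy u / (2 * η) + η * (‖u‖ ^ 2 + ‖u‖ ^ 2) := by gcongr
      _ = _ := by ring
  · set a := u (i + k • hexDir 0)
    set b := u (i + k • hexDir 0 + hexDir 0)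
    have h1 : (b - a) ^ 2 ≤ energyDensity u (i + k • hexDir 0) := by
      unfold energyDensity
      nlinarith [sq_nonneg (u (i + k • hexDir 0 + hexDir 1) - u (i + k • hexDir 0)),
        sq_nonneg (u (i + k • hexDir 0 + hexDir 2) - u (i + k • hexDir 0))]
    -- Weighted AM-GM on `(a - b)(a + b)`, then `(a + b)² ≤ 2(a² + b²)`.
    have h2 : a ^ 2 - b ^ 2 ≤ (b - a) ^ 2 / (2 * η) + η * (a ^ 2 + b ^ 2) := by
      rw [← sub_le_iff_le_add, le_div_iff₀ (by positivity)]
      nlinarith [sq_nonneg ((b - a) + η * (a + b)), mul_nonneg (sq_nonneg η) (sq_nonneg (a - b))]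
    refine h2.trans ?_
    gcongr

/-- The edge that leaves `p.1` in the direction `p.2`, one of `1`, `ω`, `ω - 1`. -/
def hexEdge (p : HexVertex × Fin 3) : hexGraph.edgeSet :=
  ⟨s(p.1, p.1 + hexDir (p.2.castLE (by norm_num))),
    hexGraph_adj_iff.2 ⟨p.2.castLE (by norm_num), add_sub_cancel_left _ _⟩⟩

lemma hexDir_eq_or_neg : ∀ m : Fin 6, ∃ n : Fin 3,
    hexDir m = hexDir (n.castLE (by norm_num)) ∨ hexDir m = -hexDir (n.castLE (by norm_num)) := by
  decide

/-- A section of this map embeds the edges into vertex-direction pairs, which suffices for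
summability and for an upper bound on the energy. -/
lemma hexEdge_surjective : Function.Surjective hexEdge := by
  rintro ⟨e, he⟩
  induction e with
  | h i j =>
    obtain ⟨m, hm⟩ := hexGraph_adj_iff.1 he
    obtain ⟨n, hn | hn⟩ := hexDir_eq_or_neg m
    · exact ⟨(i, n), Subtype.ext (by simp only [hexEdge, ← hn, ← hm]; simp)⟩
    · refine ⟨(j, n), Subtype.ext ?_⟩
      have : hexDir (n.castLE (by norm_num)) = i - j := by rw [← neg_sub, hm, hn, neg_neg]
      simp only [hexEdge, this]
      simp [Sym2.eq_swap]

lemma edgeDiffSq_nonneg (u : HexVertex → ℝ) (e : Sym2 HexVertex) : 0 ≤ edgeDiffSq u e := by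
  induction e with
  | h i j => exact sq_nonneg _

lemma hasSum_edgeDiffSq_hexEdge (u : HexL2) :
    HasSum (fun p => edgeDiffSq u (hexEdge p)) (l2Energy u) := by
  have hterm : ∀ i (n : Fin 3), edgeDiffSq u (hexEdge (i, n))
      = (u (i + hexDir (n.castLE (by norm_num))) - u i) ^ 2 := fun i n => by
    simp only [hexEdge, edgeDiffSq, Sym2.lift_mk, sq_abs]
    ring
  have hfib : ∀ i, ∑' n : Fin 3, edgeDiffSq u (hexEdge (i, n)) = energyDensity u i := fun i => by
    rw [tsum_fintype, Fin.sum_univ_three, hterm, hterm, hterm]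
    rfl
  have hs : Summable fun p => edgeDiffSq u (hexEdge p) :=
    (summable_prod_of_nonneg fun p => edgeDiffSq_nonneg _ _).2
      ⟨fun i => (hasSum_fintype _).summable, by
        simp only [hfib]
        exact summable_energyDensity u⟩
  have h2 := hs.tsum_prod
  simp only [hfib] at h2
  rw [l2Energy, ← h2]
  exact hs.hasSum

lemma summable_edgeDiffSq (u : HexL2) :
    Summable fun e : hexGraph.edgeSet => edgeDiffSq u e := by
  have := (hasSum_edgeDiffSq_hexEdge u).summable.comp_injective
    (Function.injective_surjInv hexEdge_surjective)
  simpa only [Function.comp_def, Function.surjInv_eq] using this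

lemma dirichletEnergy_nonneg (u : HexVertex → ℝ) : 0 ≤ dirichletEnergy u :=
  tsum_nonneg fun e => edgeDiffSq_nonneg u e

lemma dirichletEnergy_le (u : HexL2) : dirichletEnergy u ≤ l2Energy u := by
  have := tsum_comp_le_tsum_of_inj (hasSum_edgeDiffSq_hexEdge u).summable
    (fun _ => edgeDiffSq_nonneg _ _) (Function.injective_surjInv hexEdge_surjective)
  simp only [Function.comp_def, Function.surjInv_eq] at this
  exact this.trans_eq (hasSum_edgeDiffSq_hexEdge u).tsum_eq

/-! ### Long-time behaviour -/

/-- A Lipschitz curve in `ℓ²(V_H)` along which the norm dissipates the energy has energy tending to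
zero. -/
lemma tendsto_l2Energy_of_dissipation {α : ℝ → HexL2} {M : ℝ} (hM : 0 < M)
    (hlip : ∀ s t, 0 ≤ s → s ≤ t → ‖α t - α s‖ ≤ M * (t - s))
    (hdiss : ∀ a b c, 0 ≤ a → a ≤ b → (∀ t ∈ Set.Icc a b, c ≤ l2Energy (α t)) →
      ‖α b‖ ^ 2 - ‖α a‖ ^ 2 ≤ -(1 / 4) * c * (b - a)) :
    Filter.Tendsto (fun t => l2Energy (α t)) Filter.atTop (nhds 0) := by
  -- Truncating time at `0` gives a monotone function on all of `ℝ`, whose limit makes the norm drop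
  -- over windows of length `δ` tend to zero.
  have hanti : Antitone fun t => ‖α (max t 0)‖ ^ 2 := fun s t hst => by
    have := hdiss (max s 0) (max t 0) 0 (le_max_right _ _) (max_le_max_right 0 hst)
      (fun _ _ => l2Energy_nonneg _)
    simp only
    linarith
  have hlim := tendsto_atTop_ciInf hanti ⟨0, by rintro _ ⟨t, rfl⟩; positivity⟩
  rw [Metric.tendsto_atTop]
  intro ε hε
  obtain ⟨δ, hδ, hδε⟩ : ∃ δ > 0, 24 * (M * δ) ^ 2 ≤ ε / 2 := by
    refine ⟨√(ε / 48) / M, by positivity, le_of_eq ?_⟩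
    rw [mul_div_cancel₀ _ hM.ne', Real.sq_sqrt (by positivity)]
    ring
  have hdiff : Filter.Tendsto (fun t => ‖α (max t 0)‖ ^ 2 - ‖α (max (t + δ) 0)‖ ^ 2)
      Filter.atTop (nhds 0) := by
    have := hlim.sub (hlim.comp (Filter.tendsto_atTop_add_const_right _ δ Filter.tendsto_id))
    simpa using this
  obtain ⟨T, hT⟩ := Filter.eventually_atTop.1
    (hdiff.eventually (gt_mem_nhds (show 0 < 1 / 16 * ε * δ by positivity)))
  refine ⟨max T 0, fun t ht => ?_⟩
  have ht0 : 0 ≤ t := (le_max_right _ _).trans ht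
  have h1 := hT t ((le_max_left _ _).trans ht)
  rw [max_eq_left ht0, max_eq_left (by positivity)] at h1
  rw [Real.dist_eq, sub_zero, abs_of_nonneg (l2Energy_nonneg _)]
  by_contra! hcon
  -- If the energy is at least `ε` at `t`, it stays above `ε / 4` on `[t, t + δ]`, forcing a norm
  -- drop of `ε * δ / 16`, which `h1` excludes.
  have h2 := hdiss t (t + δ) (ε / 4) ht0 (by linarith) fun s hs => by
    have e1 := l2Energy_le_two_mul_add (α t) (α s)
    have e2 : ‖α t - α s‖ ≤ M * δ := by
      rw [norm_sub_rev]
      refine (hlip t s ht0 hs.1).trans ?_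
      gcongr
      linarith [hs.2]
    have e3 : 24 * ‖α t - α s‖ ^ 2 ≤ 24 * (M * δ) ^ 2 := by gcongr
    linarith
  rw [add_sub_cancel_left] at h2
  linarith

/-- If the energy tends to zero along a bounded curve in `ℓ²(V_H)`, the curve tends to zero
uniformly on `V_H`. -/
lemma eventually_abs_lt_of_tendsto_l2Energy {α : ℝ → HexL2} {R : ℝ}
    (hR : ∀ t, 0 ≤ t → ‖α t‖ ≤ R)
    (hE : Filter.Tendsto (fun t => l2Energy (α t)) Filter.atTop (nhds 0)) {δ : ℝ} (hδ : 0 < δ) :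
    ∀ᶠ t in Filter.atTop, ∀ i, |α t i| < δ := by
  have hη : 0 < δ ^ 2 / (4 * (R ^ 2 + 1)) := by positivity
  set η := δ ^ 2 / (4 * (R ^ 2 + 1)) with hηdef
  filter_upwards [hE.eventually (gt_mem_nhds (show 0 < η * δ ^ 2 / 2 by positivity)),
    Filter.eventually_ge_atTop 0] with t ht ht0 i
  have h1 := sq_le_l2Energy (α t) hη i
  have h2 : l2Energy (α t) / (2 * η) < δ ^ 2 / 4 := by
    rw [div_lt_iff₀ (by positivity)]
    linarith
  have h3 : 2 * η * ‖α t‖ ^ 2 ≤ δ ^ 2 / 2 := by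
    have : ‖α t‖ ^ 2 ≤ R ^ 2 + 1 := by
      have := pow_le_pow_left₀ (norm_nonneg _) (hR t ht0) 2
      linarith
    calc 2 * η * ‖α t‖ ^ 2 ≤ 2 * η * (R ^ 2 + 1) := by gcongr
      _ = δ ^ 2 / 2 := by rw [hηdef]; field_simp; ring
  refine abs_lt_of_sq_lt_sq ?_ hδ.le
  nlinarith

/-! ### Uniqueness and global existence -/

/-- Two solutions of the flow whose difference at time zero vanishes agree, if one of them stays
close to zero. -/
lemma CornerAngleBounds.flow_unique {K r : ℝ} (h : CornerAngleBounds K r)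
    {u v : ℝ → HexVertex → ℝ} (hu : ∀ t, 0 ≤ t → ∀ i, |u t i| ≤ r / 4) (h0 : v 0 = u 0)
    (hu' : ∀ t, 0 ≤ t → ∀ i,
      HasDerivWithinAt (fun s => u s i) (flowField (u t) i) (Set.Ici 0) t)
    (hv' : ∀ t, 0 ≤ t → ∀ i,
      HasDerivWithinAt (fun s => v s i) (flowField (v t) i) (Set.Ici 0) t) :
    ∀ t, 0 ≤ t → v t = u t := by
  have hK := h.K_pos
  have hr := h.r_pos
  -- The first bound lets `v` drift from `r / 4` to at most `r / 2` during a step; the second makes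
  -- the integrated Lipschitz estimate contract by `1 / 2`.
  obtain ⟨c, hc, hcr, hcK⟩ : ∃ c > 0, 6 * Real.pi * c ≤ r / 4 ∧ 24 * K * c ≤ 1 / 2 := by
    refine ⟨min (r / 4 / (6 * Real.pi)) (1 / 2 / (24 * K)), by positivity, ?_, ?_⟩
    · rw [← le_div_iff₀' (by positivity)]; exact min_le_left _ _
    · rw [← le_div_iff₀' (by positivity)]; exact min_le_right _ _
  have hstep : ∀ a, 0 ≤ a → v a = u a → ∀ t ∈ Set.Icc a (a + c), v t = u t := by
    intro a ha hva
    have hv : ∀ t ∈ Set.Icc a (a + c), ∀ i, |v t i| ≤ r / 2 := fun t ht i => by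
      have h1 := norm_sub_le_of_hasDerivWithinAt_Ici (fun t ht => hv' t ht i) ha ht.1
        (fun t _ => abs_flowField_le (v t) i)
      have h2 : 6 * Real.pi * (t - a) ≤ 6 * Real.pi * c := by
        gcongr; linarith [ht.2]
      have h3 := hu a ha i
      rw [Real.norm_eq_abs, hva] at h1
      linarith [abs_sub_abs_le_abs_sub (v t i) (u a i)]
    have hu2 : ∀ t ∈ Set.Icc a (a + c), ∀ i, |u t i| ≤ r / 2 := fun t ht i =>
      (hu t (ha.trans ht.1) i).trans (by linarith)
    -- A sup-norm contraction carried out coordinatewise, since `v - u` is not known to be a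
    -- differentiable curve in a Banach space.
    have hiter : ∀ n : ℕ, ∀ t ∈ Set.Icc a (a + c), ∀ i, |v t i - u t i| ≤ r * (1 / 2) ^ n := by
      intro n
      induction n with
      | zero => intro t ht i; linarith [abs_sub (v t i) (u t i), hv t ht i, hu2 t ht i]
      | succ n ih =>
        intro t ht i
        have h1 := norm_sub_le_of_hasDerivWithinAt_Ici (a := a) (b := t)
          (C := 24 * K * (r * (1 / 2) ^ n))
          (fun t ht => (hv' t ht i).sub (hu' t ht i)) ha ht.1 (fun s hs => by
            have hs' : s ∈ Set.Icc a (a + c) := ⟨hs.1, hs.2.trans ht.2⟩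
            exact h.abs_flowField_sub_le_of_forall_abs_le (hv s hs') (hu2 s hs') (ih s hs') i)
        simp only [Pi.sub_apply, hva, sub_self, sub_zero, Real.norm_eq_abs] at h1
        have h2 : t - a ≤ c := by linarith [ht.2]
        calc |v t i - u t i| ≤ 24 * K * (r * (1 / 2) ^ n) * (t - a) := h1
          _ ≤ 24 * K * (r * (1 / 2) ^ n) * c := by gcongr
          _ = 24 * K * c * (r * (1 / 2) ^ n) := by ring
          _ ≤ 1 / 2 * (r * (1 / 2) ^ n) := by gcongr
          _ = _ := by ring
    intro t ht
    ext i
    have hlim : Filter.Tendsto (fun n : ℕ => r * (1 / 2 : ℝ) ^ n) Filter.atTop (nhds 0) := by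
      simpa using (tendsto_pow_atTop_nhds_zero_of_lt_one (by norm_num : (0 : ℝ) ≤ 1 / 2)
        (by norm_num)).const_mul r
    have := ge_of_tendsto' hlim fun n => hiter n t ht i
    exact sub_eq_zero.1 (abs_nonpos_iff.1 this)
  have hall : ∀ n : ℕ, ∀ t ∈ Set.Icc 0 (n * c), v t = u t := by
    intro n
    induction n with
    | zero =>
      intro t ht
      obtain rfl : t = 0 := le_antisymm (by simpa using ht.2) ht.1
      exact h0
    | succ n ih =>
      intro t ht
      rcases le_total t (n * c) with htn | htn
      · exact ih t ⟨ht.1, htn⟩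
      · have hn : 0 ≤ n * c := by positivity
        exact hstep (n * c) hn (ih _ ⟨hn, le_rfl⟩) t
          ⟨htn, ht.2.trans (by push_cast; linarith)⟩
  intro t ht
  obtain ⟨n, hn⟩ := exists_nat_ge (t / c)
  exact hall n t ⟨ht, (div_le_iff₀ hc).1 hn⟩

/-- For small initial data in `ℓ²(V_H)` the flow has a global solution in `ℓ²(V_H)` along which the
norm is bounded by its initial value and the energy tends to zero. -/
lemma CornerAngleBounds.exists_l2_flow {K r : ℝ} (h : CornerAngleBounds K r) {ρ : ℝ} (hρ : 0 < ρ)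
    (hρr : ρ ≤ r / 2) (hρK : 16 * K * ρ ≤ 1) {φ : HexL2} (hφ : ‖φ‖ ≤ ρ) :
    ∃ α : ℝ → HexL2, α 0 = φ ∧ (∀ t, 0 ≤ t → ‖α t‖ ≤ ‖φ‖) ∧
      (∀ t, 0 ≤ t → ∀ i,
        HasDerivWithinAt (fun s => α s i) (flowField (α t) i) (Set.Ici 0) t) ∧
      Filter.Tendsto (fun t => l2Energy (α t)) Filter.atTop (nhds 0) := by
  have hK := h.K_pos
  -- The retraction makes the field globally bounded and Lipschitz. It rescales `x` by a positive
  -- factor, so the sign of `inner ℝ x (G x)` is still given by the dissipation estimate.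
  set G : HexL2 → HexL2 := fun x => l2Field (radialRetraction ρ x) with hG
  have hret : ∀ x : HexL2, ‖radialRetraction ρ x‖ ≤ r / 2 := fun x =>
    (norm_radialRetraction_le hρ x).trans hρr
  have hGM : ∀ x, ‖G x‖ ≤ 24 * K * ρ := fun x =>
    (h.norm_l2Field_le (hret x)).trans (by gcongr; exact norm_radialRetraction_le hρ x)
  have hGlip : LipschitzWith (48 * K).toNNReal G := LipschitzWith.of_dist_le_mul fun x y => by
    rw [dist_eq_norm, dist_eq_norm, Real.coe_toNNReal _ (by positivity)]
    calc ‖G x - G y‖ ≤ 24 * K * ‖radialRetraction ρ x - radialRetraction ρ y‖ :=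
          h.norm_l2Field_sub_le (hret x) (hret y)
      _ ≤ 24 * K * (2 * ‖x - y‖) := by gcongr; exact norm_radialRetraction_sub_le hρ x y
      _ = _ := by ring
  obtain ⟨α, hα0, hα⟩ := exists_forward_integralCurve (M := (24 * K * ρ).toNNReal) hGlip
    (fun x => by rw [Real.coe_toNNReal _ (by positivity)]; exact hGM x) φ
  have hnorm : ∀ t, 0 ≤ t → HasDerivWithinAt (fun s => ‖α s‖ ^ 2)
      (2 * inner ℝ (α t) (G (α t))) (Set.Ici 0) t := fun t ht => (hα t ht).norm_sq
  have hinner : ∀ x : HexL2, inner ℝ x (G x) ≤ 0 := fun x => by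
    have h1 := h.inner_l2Field_le hρr hρK (norm_radialRetraction_le hρ x)
    have h2 := l2Energy_nonneg (radialRetraction ρ x)
    have hl : 0 < ρ / max ρ ‖x‖ := div_pos hρ (lt_max_of_lt_left hρ)
    have h3 : inner ℝ (radialRetraction ρ x) (G x) = ρ / max ρ ‖x‖ * inner ℝ x (G x) := by
      rw [radialRetraction, real_inner_smul_left]
    have h4 : ρ / max ρ ‖x‖ * inner ℝ x (G x) ≤ 0 := by
      rw [← h3]
      exact h1.trans (by linarith)
    exact nonpos_of_mul_nonpos_right h4 hl
  have hbound : ∀ t, 0 ≤ t → ‖α t‖ ≤ ‖φ‖ := fun t ht => by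
    have := sub_le_mul_sub_of_hasDerivWithinAt_Ici hnorm le_rfl ht (C := 0)
      (fun s _ => by linarith [hinner (α s)])
    rw [hα0] at this
    exact le_of_sq_le_sq (by linarith) (norm_nonneg _)
  have hGα : ∀ t, 0 ≤ t → G (α t) = l2Field (α t) := fun t ht => by
    simp only [hG, radialRetraction_of_norm_le hρ ((hbound t ht).trans hφ)]
  refine ⟨α, hα0, hbound, fun t ht i => ?_, ?_⟩
  · have h1 := (lp.evalCLM ℝ (fun _ : HexVertex => ℝ) 2 i).hasFDerivAt.comp_hasDerivWithinAt t
      (hα t ht)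
    rw [hGα t ht] at h1
    have h2 := h.l2Field_apply (((hbound t ht).trans hφ).trans hρr) i
    rw [← h2]
    exact h1
  · refine tendsto_l2Energy_of_dissipation (M := 24 * K * ρ) (by positivity)
      (fun s t hs hst => norm_sub_le_of_hasDerivWithinAt_Ici hα hs hst fun t _ => hGM _)
      (fun a b c ha hab hc => ?_)
    refine sub_le_mul_sub_of_hasDerivWithinAt_Ici hnorm ha hab fun t ht => ?_
    have ht0 := ha.trans ht.1
    have := h.inner_l2Field_le hρr hρK ((hbound t ht0).trans hφ)
    rw [hGα t ht0]
    linarith [hc t ht]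

/-! ### The main theorem -/

theorem theorem1p7 :
    ∃ ε₀ : ℝ, 0 < ε₀ ∧
      ∀ φ : lp (fun _ : HexVertex => ℝ) 2, ‖φ‖ ≤ ε₀ →
        ∃ u : ℝ → HexVertex → ℝ,
          IsGlobalYamabeFlow φ u ∧
          (∀ v : ℝ → HexVertex → ℝ, IsGlobalYamabeFlow φ v → ∀ t, 0 ≤ t → v t = u t) ∧
          (∀ t, 0 ≤ t → Summable fun e : hexGraph.edgeSet => edgeDiffSq (u t) e) ∧
          Filter.Tendsto (fun t => dirichletEnergy (u t)) Filter.atTop (nhds 0) ∧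
          TendstoUniformlyOn
            (fun t (p : HexVertex × HexVertex) =>
              conformalChange (u t) regularMetric p.1 p.2)
            (fun p => regularMetric p.1 p.2) Filter.atTop
            {p | hexGraph.Adj p.1 p.2} := by
  obtain ⟨K, hK, r, hr, hlip, hquad⟩ := exists_cornerAngle_bounds
  have h : CornerAngleBounds K r := ⟨hK, hr, hlip, hquad⟩
  -- The three bounds serve the triangle inequalities, the room needed for uniqueness, and the
  -- absorption of the quadratic error.
  obtain ⟨ρ, hρ, hρ1, hρr, hρK⟩ : ∃ ρ > 0, ρ ≤ 1 / 4 ∧ ρ ≤ r / 4 ∧ 16 * K * ρ ≤ 1 := by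
    refine ⟨min (1 / 4) (min (r / 4) (1 / (16 * K))), by positivity, min_le_left _ _,
      (min_le_right _ _).trans (min_le_left _ _), ?_⟩
    rw [← le_div_iff₀' (by positivity)]
    exact (min_le_right _ _).trans (min_le_right _ _)
  refine ⟨ρ, hρ, fun φ hφ => ?_⟩
  obtain ⟨α, hα0, hbound, hderiv, hE⟩ := h.exists_l2_flow hρ (by linarith) hρK hφ
  have hsup : ∀ t, 0 ≤ t → ∀ i, |α t i| ≤ ρ := fun t ht i =>
    ((α t).abs_le_norm i).trans ((hbound t ht).trans hφ)
  refine ⟨fun t => α t, ⟨by rw [hα0], fun t ht =>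
    isPLMetric_conformalChange fun i => (hsup t ht i).trans hρ1, fun t ht i => ?_⟩,
    fun v hv => ?_, fun t _ => summable_edgeDiffSq (α t), ?_, ?_⟩
  · rw [neg_discreteCurvature]
    exact hderiv t ht i
  · refine h.flow_unique (fun t ht i => (hsup t ht i).trans hρr) (by rw [hv.initial, hα0]) hderiv
      fun t ht i => ?_
    rw [← neg_discreteCurvature]
    exact hv.flow t ht i
  · exact squeeze_zero (fun t => dirichletEnergy_nonneg _) (fun t => dirichletEnergy_le (α t)) hE
  · rw [Metric.tendstoUniformlyOn_iff]
    intro ε hε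
    have hδ : 0 < min 1 (ε / 2) := by positivity
    filter_upwards [eventually_abs_lt_of_tendsto_l2Energy hbound hE hδ] with t ht p _
    have h1 := ht p.1
    have h2 := ht p.2
    have hx : |(α t p.1 + α t p.2) / 2| < min 1 (ε / 2) := by
      rw [abs_div, abs_two]
      linarith [abs_add_le (α t p.1) (α t p.2)]
    -- The bound `|exp x - 1| ≤ 2|x|` for `|x| ≤ 1` explains the choice `min 1 (ε / 2)`.
    have h3 := Real.abs_exp_sub_one_le (hx.le.trans (min_le_left _ _))
    simp only [conformalChange, regularMetric, mul_one]
    rw [dist_comm, Real.dist_eq]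
    linarith [hx.trans_le (min_le_right _ _)]
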